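/- Let $\Bbbk$ be an algebraically closed field and let $G$ be a connected affine algebraic group over $\Bbbk$ with algebra of polynomial functions $\Bbbk[G]$. For $x\in G$ and $f\in\Bbbk[G]$ let $x\cdot f\in\Bbbk[G]$ be the translate $(x\cdot f)(y)=f(yx)$, $y \in G$. Let $\mathfrak H$ be the set of all closed subgroups of $G$ and $\mathfrak R$ the set of all $\Bbbk$-subalgebras of $\Bbbk[G]$, both ordered by inclusion, and consider the maps $$\mathfrak H\to\mathfrak R,\quad H\mapsto H'={}^H\Bbbk[G]=\{f\in\Bbbk[G]: x\cdot f=f\ \text{ for all } x\in H\},$$ $$\mathfrak R\to\mathfrak H,\quad R\mapsto R'=\operatorname{Stab}(R)=\{x\in G: x\cdot r=r\ \text{ for all } r\in R\}.$$ A closed subgroup $H\subseteq G$ is called observable in $G$ if every finite dimensional rational $H$-module is isomorphic to an $H$-submodule of (the restriction to $H$ of) some finite dimensional rational $G$-module. Then these two maps form an order-inverting Galois connection, that is, $R\subseteq H'$ if and only if $H\subseteq R'$, for all $H\in\mathfrak H$ and $R\in\mathfrak R$. Moreover, the closed subgroups $H$ with $H''=H$ are exactly the observable subgroups of $G$. 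-/

import Mathlib

universe u v w

/-- The structure of an affine algebraic group over `k` on an abstract group `G`
(in the classical sense, `k` being algebraically closed in the applications).
It is given by the algebra `k[G]` of polynomial functions on `G`: a finitely generated algebra of
`k`-valued functions such that `G` is identified, through evaluation, with the set of all
`k`-algebra homomorphisms `k[G] → k` (that is, `(G, k[G])` is an affine variety), and such that
multiplication `G × G → G` and inversion `G → G` are morphisms of affine varieties. -/
structure AffineAlgebraicGroup (k : Type u) (G : Type v) [Field k] [Group G] where
  /-- the algebra `k[G]` of polynomial functions -/
  coordRing : Subalgebra k (G → k)
  fg : coordRing.FG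
  bijective_eval :
    Function.Bijective (fun x : G => (Pi.evalAlgHom k (fun _ : G => k) x).comp coordRing.val)
  mul_mem : ∀ f ∈ coordRing, ∃ (n : ℕ) (f₁ f₂ : Fin n → coordRing),
    ∀ x y : G, f (x * y) = ∑ i, (f₁ i : G → k) x * (f₂ i : G → k) y
  inv_mem : ∀ f ∈ coordRing, (fun x => f x⁻¹) ∈ coordRing

namespace AffineAlgebraicGroup

section Basic

variable {k : Type u} {G : Type v} [Field k] [Group G] (𝔾 : AffineAlgebraicGroup k G)

/-- The set of common zeros in `G` of a set `S` of polynomial functions. -/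
def zeroLocus (S : Set 𝔾.coordRing) : Set G := {x | ∀ f ∈ S, (f : G → k) x = 0}

/-- The Zariski topology of `G`: the closed sets are the zero loci of sets of polynomial
functions. -/
abbrev zariskiTopology : TopologicalSpace G :=
  TopologicalSpace.ofClosed {Z | ∃ S, Z = 𝔾.zeroLocus S}
    ⟨{1}, by ext x; simp [zeroLocus]⟩
    (by
      intro A hA
      refine ⟨{f | ∃ Z ∈ A, ∀ x ∈ Z, (f : G → k) x = 0}, ?_⟩
      ext x
      constructor
      · rintro hx f ⟨Z, hZ, hf⟩
        exact hf x (hx Z hZ)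
      · intro hx Z hZ
        obtain ⟨S, rfl⟩ := hA hZ
        exact fun f hf => hx f ⟨_, hZ, fun y hy => hy f hf⟩)
    (by
      rintro _ ⟨S, rfl⟩ _ ⟨T, rfl⟩
      refine ⟨{h | ∃ f ∈ S, ∃ g ∈ T, h = f * g}, ?_⟩
      ext x
      constructor
      · rintro (hx | hx)
        · rintro _ ⟨f, hf, g, hg, rfl⟩
          simp [hx f hf]
        · rintro _ ⟨f, hf, g, hg, rfl⟩
          simp [hx g hg]
      · intro hx
        by_contra hcon
        have h1 : ¬ ∀ f ∈ S, (f : G → k) x = 0 := fun h => hcon (Or.inl h)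
        have h2 : ¬ ∀ g ∈ T, (g : G → k) x = 0 := fun h => hcon (Or.inr h)
        push Not at h1 h2
        obtain ⟨f, hf, hf0⟩ := h1
        obtain ⟨g, hg, hg0⟩ := h2
        have := hx (f * g) ⟨f, hf, g, hg, rfl⟩
        simp [hf0, hg0] at this)

theorem isClosed_iff (Z : Set G) :
    @IsClosed G 𝔾.zariskiTopology Z ↔ ∃ S, Z = 𝔾.zeroLocus S := by
  rw [← @isOpen_compl_iff G Z 𝔾.zariskiTopology]
  change Zᶜᶜ ∈ _ ↔ _
  rw [compl_compl]
  rfl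

/-- `G` is connected, in its Zariski topology. -/
def IsConnected : Prop := @ConnectedSpace G 𝔾.zariskiTopology

/-- The set `𝓗` of all closed subgroups of `G`, ordered by inclusion. -/
abbrev ClosedSubgroup : Type v :=
  {H : Subgroup G // @IsClosed G 𝔾.zariskiTopology (H : Set G)}

/-- The algebra homomorphism `f ↦ x · f` of `k[G]`, where `(x · f) y = f (y x)`. -/
def translate (x : G) : 𝔾.coordRing →ₐ[k] 𝔾.coordRing where
  toFun f := ⟨fun y => (f : G → k) (y * x), by
    obtain ⟨n, f₁, f₂, h⟩ := 𝔾.mul_mem f f.2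
    have : (fun y => (f : G → k) (y * x)) =
        ∑ i, (f₂ i : G → k) x • (f₁ i : G → k) := by
      ext y
      simp [h, mul_comm]
    rw [this]
    exact Subalgebra.sum_mem _ fun i _ => Subalgebra.smul_mem _ (f₁ i).2 _⟩
  map_one' := rfl
  map_mul' _ _ := rfl
  map_zero' := rfl
  map_add' _ _ := rfl
  commutes' _ := rfl

@[simp]
theorem translate_apply (x y : G) (f : 𝔾.coordRing) :
    (𝔾.translate x f : G → k) y = (f : G → k) (y * x) := rfl

/-- The functions `y ↦ f (x y)` are polynomial. -/
theorem comp_mul_left_mem (x : G) (f : 𝔾.coordRing) :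
    (fun y => (f : G → k) (x * y)) ∈ 𝔾.coordRing := by
  obtain ⟨n, f₁, f₂, h⟩ := 𝔾.mul_mem f f.2
  have : (fun y => (f : G → k) (x * y)) = ∑ i, (f₁ i : G → k) x • (f₂ i : G → k) := by
    ext y
    simp [h]
  rw [this]
  exact Subalgebra.sum_mem _ fun i _ => Subalgebra.smul_mem _ (f₂ i).2 _

/-- The map `𝔽 : H ↦ H' = ᴴk[G] = {f ∈ k[G] : x · f = f for all x ∈ H}`. -/
def fixedSubalgebra (H : 𝔾.ClosedSubgroup) : Subalgebra k 𝔾.coordRing where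
  carrier := {f | ∀ x ∈ H.1, 𝔾.translate x f = f}
  mul_mem' hf hg x hx := by rw [map_mul, hf x hx, hg x hx]
  add_mem' hf hg x hx := by rw [map_add, hf x hx, hg x hx]
  algebraMap_mem' r x _ := (𝔾.translate x).commutes r

/-- The map `𝕊 : R ↦ R' = Stab(R) = {x ∈ G : x · r = r for all r ∈ R}`. -/
def stab (R : Subalgebra k 𝔾.coordRing) : 𝔾.ClosedSubgroup :=
  ⟨{ carrier := {x | ∀ r ∈ R, 𝔾.translate x r = r}
     one_mem' := fun r _ => by ext y; simp
     mul_mem' := fun {a b} ha hb r hr => by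
      ext y
      have h1 := congrFun (congrArg Subtype.val (hb r hr)) (y * a)
      have h2 := congrFun (congrArg Subtype.val (ha r hr)) y
      simp only [translate_apply] at h1 h2 ⊢
      rw [← mul_assoc, h1, h2]
     inv_mem' := fun {a} ha r hr => by
      ext y
      have h := congrFun (congrArg Subtype.val (ha r hr)) (y * a⁻¹)
      simp only [translate_apply] at h ⊢
      rw [← h, inv_mul_cancel_right] },
   by
    rw [isClosed_iff]
    refine ⟨{f | ∃ r ∈ R, ∃ y : G, ∀ x, (f : G → k) x = (r : G → k) (y * x) - (r : G → k) y}, ?_⟩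
    ext x
    constructor
    · rintro hx f ⟨r, hr, y, hf⟩
      have h := congrFun (congrArg Subtype.val (hx r hr)) y
      simp only [translate_apply] at h
      rw [hf, h, sub_self]
    · intro hx r hr
      ext y
      have hmem := Subalgebra.sub_mem _ (𝔾.comp_mul_left_mem y r)
        (𝔾.coordRing.algebraMap_mem ((r : G → k) y))
      exact sub_eq_zero.1 (hx ⟨_, hmem⟩ ⟨r, hr, y, fun _ => rfl⟩)⟩

/-- A representation of `G` on a `k`-module `M`, not necessarily finite dimensional, is rational
when it comes from a coaction `M → M ⊗ k[G]`, `m ↦ ∑ mᵢ ⊗ fᵢ`, through `x · m = ∑ fᵢ(x) mᵢ`. -/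
def IsRational {M : Type w} [AddCommGroup M] [Module k M] (ρ : Representation k G M) : Prop :=
  ∀ m : M, ∃ (n : ℕ) (m' : Fin n → M) (f : Fin n → 𝔾.coordRing),
    ∀ x : G, ρ x m = ∑ i, (f i : G → k) x • m' i

/-- Restriction of functions from `G` to a subgroup `H`. -/
def restrict (H : Subgroup G) : (G → k) →ₐ[k] (H → k) where
  toFun f x := f x
  map_one' := rfl
  map_mul' _ _ := rfl
  map_zero' := rfl
  map_add' _ _ := rfl
  commutes' _ := rfl

/-- A closed subgroup `H` of `G` as an affine algebraic group: `k[H]` consists of the restrictions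
to `H` of the elements of `k[G]`. -/
def toAffineAlgebraicGroup (H : 𝔾.ClosedSubgroup) : AffineAlgebraicGroup k H.1 where
  coordRing := 𝔾.coordRing.map (restrict H.1)
  fg := 𝔾.fg.map _
  bijective_eval := by
    constructor
    · intro x y hxy
      apply Subtype.ext
      apply 𝔾.bijective_eval.1
      ext f
      exact DFunLike.congr_fun hxy ⟨restrict H.1 f, f, f.2, rfl⟩
    · intro φ
      let π : 𝔾.coordRing →ₐ[k] (𝔾.coordRing.map (restrict H.1)) :=
        ((restrict H.1).comp 𝔾.coordRing.val).codRestrict _ fun f => ⟨f, f.2, rfl⟩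
      obtain ⟨x, hx⟩ := 𝔾.bijective_eval.2 (φ.comp π)
      have hx' : ∀ f : 𝔾.coordRing, (f : G → k) x = φ (π f) := fun f => DFunLike.congr_fun hx f
      have hxH : x ∈ H.1 := by
        obtain ⟨S, hS⟩ := (𝔾.isClosed_iff _).1 H.2
        change x ∈ (H.1 : Set G)
        rw [hS]
        intro f hf
        have h0 : π f = 0 := by
          ext y
          have hy : (y : G) ∈ (H.1 : Set G) := y.2
          rw [hS] at hy
          exact hy f hf
        rw [hx', h0, map_zero]
      refine ⟨⟨x, hxH⟩, ?_⟩
      ext ⟨_, f, hf, rfl⟩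
      exact hx' ⟨f, hf⟩
  mul_mem := by
    rintro _ ⟨f, hf, rfl⟩
    obtain ⟨n, f₁, f₂, h⟩ := 𝔾.mul_mem f hf
    exact ⟨n, fun i => ⟨restrict H.1 (f₁ i), f₁ i, (f₁ i).2, rfl⟩,
      fun i => ⟨restrict H.1 (f₂ i), f₂ i, (f₂ i).2, rfl⟩, fun x y => h x y⟩
  inv_mem := by
    rintro _ ⟨f, hf, rfl⟩
    exact ⟨_, 𝔾.inv_mem f hf, rfl⟩

/-- A closed subgroup `H` is observable in `G` when every finite dimensional rational
representation `σ` of `H` can be extended to a finite dimensional rational representation `ρ`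
of `G`: there is an injective `H`-equivariant linear map from the first into the restriction to
`H` of the second. (Every finite dimensional space over `k` has a copy in the universe of `k`.) -/
def IsObservable (H : 𝔾.ClosedSubgroup) : Prop :=
  ∀ (M : Type u) [AddCommGroup M] [Module k M] [Module.Finite k M] (σ : Representation k H.1 M),
    (𝔾.toAffineAlgebraicGroup H).IsRational σ →
    ∃ (N : Type u) (_ : AddCommGroup N) (_ : Module k N) (_ : Module.Finite k N)
      (ρ : Representation k G N) (ι : M →ₗ[k] N),
      𝔾.IsRational ρ ∧ Function.Injective ι ∧ ∀ (x : H.1) (m : M), ι (σ x m) = ρ x (ι m)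

end Basic

end AffineAlgebraicGroup

/-
Let `H'' = H`. The zero set of a semiinvariant `f ≠ 0` of `H` is a union of cosets of
`H = Stab(ᴴk[G])`, that is, of fibres of `G → Spec ᴴk[G]`. By the Nullstellensatz in `k[G] ⊗ k[G]`,
taken over `ᴴk[G]`, some left translate of `f` divides a nonzero invariant; so if there is a
nonzero semiinvariant of weight `χ`, there is one of weight `χ⁻¹`. Now let `K ⊆ k[G]` be a finite
dimensional `H`-submodule with basis `v₁, …, vₙ`, and let `u ∉ K`. The functions `det (vᵢ (aⱼ y))`
of `y`, with points `a₁, …, aₙ`, are semiinvariants whose weight is the determinant of `K`. For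
suitable points `a₀, …, aₙ` and a suitable semiinvariant `g` of the inverse weight, the map sending
`f` to `g` times the determinant attached to `f, v₁, …, vₙ` is therefore an `H`-endomorphism of
`k[G]` which kills `K` but not `u`. A matrix coefficient `m ↦ (h ↦ l (h m))` of an `H`-module lifts
to a linear map into `k[G]` that is equivariant modulo functions vanishing on `H`, and becomes
equivariant after such an endomorphism.

Conversely, let `H` be observable, let `x ∈ H''` and let `f` vanish on `H`. The dual of the
`H`-module `W` spanned by the translates of `f` embeds, through some `φ`, into a `G`-module. For
each linear form `l` on the latter, the function `y ↦ l (y · φ (ev_y))` is an invariant of `H`, so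
it takes the same value at `x` and at `1`. This value is `0` since `ev_1 = 0` on `W`; hence
`ev_x = 0` on `W`, and `f x = 0`.
-/

section CommutativeAlgebra

open TensorProduct

theorem exists_algHom_le_ker_of_ne_top {k B : Type*} [Field k] [IsAlgClosed k] [CommRing B]
    [Algebra k B] [Algebra.FiniteType k B] {I : Ideal B} (hI : I ≠ ⊤) :
    ∃ φ : B →ₐ[k] k, I ≤ RingHom.ker φ := by
  obtain ⟨m, hm, hIm⟩ := I.exists_le_maximal hI
  let _ := Ideal.Quotient.field m
  have := finite_of_finite_type_of_isJacobsonRing k (B ⧸ m)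
  let e : k ≃ₐ[k] (B ⧸ m) := AlgEquiv.ofBijective (Algebra.ofId k _)
    IsAlgClosed.algebraMap_bijective_of_isIntegral
  refine ⟨(e.symm : (B ⧸ m) →ₐ[k] k).comp (Ideal.Quotient.mkₐ k m), fun b hb => ?_⟩
  simp [RingHom.mem_ker, Ideal.Quotient.eq_zero_iff_mem.2 (hIm hb)]

theorem mem_radical_of_forall_algHom {k B : Type*} [Field k] [IsAlgClosed k] [CommRing B]
    [Algebra k B] [Algebra.FiniteType k B] {I : Ideal B} {b : B}
    (h : ∀ φ : B →ₐ[k] k, I ≤ RingHom.ker φ → φ b = 0) : b ∈ I.radical := by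
  have := isJacobsonRing_of_finiteType (A := k) (B := B)
  rw [Ideal.radical_eq_jacobson, Ideal.jacobson, Ideal.mem_sInf]
  rintro m ⟨hIm, hm⟩
  obtain ⟨φ, hφ⟩ := exists_algHom_le_ker_of_ne_top (k := k) hm.ne_top
  rw [hm.eq_of_le (RingHom.ker_ne_top φ) hφ]
  exact h φ (hIm.trans hφ)

theorem exists_isPrime_tensorProduct_of_comap_eq {R A B : Type*} [CommRing R] [CommRing A]
    [CommRing B] [Algebra R A] [Algebra R B] (P : Ideal A) (Q : Ideal B) [P.IsPrime] [Q.IsPrime]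
    (h : P.comap (algebraMap R A) = Q.comap (algebraMap R B)) :
    ∃ 𝔓 : Ideal (A ⊗[R] B), 𝔓.IsPrime ∧ (∀ a : A, a ⊗ₜ 1 ∈ 𝔓 ↔ a ∈ P) ∧
      ∀ b : B, 1 ⊗ₜ b ∈ 𝔓 ↔ b ∈ Q := by
  let p := P.comap (algebraMap R A)
  let fP : p.ResidueField →ₐ[R] P.ResidueField :=
    Ideal.ResidueField.mapₐ p P (Algebra.ofId R A) rfl
  let fQ : p.ResidueField →ₐ[R] Q.ResidueField :=
    Ideal.ResidueField.mapₐ p Q (Algebra.ofId R B) h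
  algebraize [fP.toRingHom, fQ.toRingHom]
  let T := P.ResidueField ⊗[p.ResidueField] Q.ResidueField
  obtain ⟨m, hm⟩ := Ideal.exists_maximal T
  let jP : P.ResidueField →ₐ[p.ResidueField] T := Algebra.TensorProduct.includeLeft
  let jQ : Q.ResidueField →ₐ[p.ResidueField] T := Algebra.TensorProduct.includeRight
  let φ : A ⊗[R] B →ₐ[R] T := Algebra.TensorProduct.lift
    ((jP.restrictScalars R).comp (IsScalarTower.toAlgHom R A _))
    ((jQ.restrictScalars R).comp (IsScalarTower.toAlgHom R B _)) fun _ _ => Commute.all _ _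
  have hjP (x) : jP x ∈ m ↔ x = 0 := by
    rw [← Ideal.mem_comap, Ideal.eq_bot_of_prime (m.comap jP), Ideal.mem_bot]
  have hjQ (x) : jQ x ∈ m ↔ x = 0 := by
    rw [← Ideal.mem_comap, Ideal.eq_bot_of_prime (m.comap jQ), Ideal.mem_bot]
  exact ⟨m.comap φ, inferInstance, by simp [φ, hjP], by simp [φ, hjQ]⟩

theorem exists_notMem_dvd_algebraMap {R A : Type*} [CommRing R] [CommRing A] [Algebra R A]
    (P : Ideal A) [P.IsPrime] (hP : P.comap (algebraMap R A) ∈ minimalPrimes R) {f : A}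
    (hfP : f ∉ P)
    (hf : (1 : A) ⊗ₜ[R] f ∈ (Ideal.span {f ⊗ₜ[R] (1 : A)}).radical) :
    ∃ r : R, algebraMap R A r ∉ P ∧ f ∣ algebraMap R A r := by
  by_contra! hdvd
  let p := P.comap (algebraMap R A)
  obtain ⟨Q, hQ, hfQ, hQp⟩ := Ideal.exists_le_prime_disjoint (Ideal.span {f})
    (p.primeCompl.map (algebraMap R A)) (by
      rw [Set.disjoint_left]
      rintro _ hr ⟨r, hrp, rfl⟩
      exact hdvd r hrp (Ideal.mem_span_singleton.1 hr))
  have hQP : Q.comap (algebraMap R A) = p :=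
    le_antisymm (fun r hr => by_contra fun hrp => Set.disjoint_left.1 hQp hr ⟨r, hrp, rfl⟩)
      (hP.2 ⟨inferInstance, bot_le⟩
        fun r hr => by_contra fun hrp => Set.disjoint_left.1 hQp hr ⟨r, hrp, rfl⟩)
  obtain ⟨𝔓, h𝔓, hleft, hright⟩ := exists_isPrime_tensorProduct_of_comap_eq Q P hQP
  refine hfP ((hright f).1 (h𝔓.radical_le_iff.2 ?_ hf))
  exact (Ideal.span_singleton_le_iff_mem _).2
    ((hleft f).2 (hfQ (Ideal.mem_span_singleton_self f)))

theorem one_tmul_mem_radical_span_tmul_one {k R A : Type*} [Field k] [IsAlgClosed k] [CommRing R]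
    [CommRing A] [Algebra k R] [Algebra k A] [Algebra R A] [IsScalarTower k R A]
    [Algebra.FiniteType k A] {f : A}
    (hf : ∀ φ ψ : A →ₐ[k] k,
      (∀ r : R, φ (algebraMap R A r) = ψ (algebraMap R A r)) → φ f = 0 → ψ f = 0) :
    (1 : A) ⊗ₜ[R] f ∈ (Ideal.span {f ⊗ₜ[R] (1 : A)}).radical := by
  have : Algebra.FiniteType R A := .of_restrictScalars_finiteType k R A
  have : Algebra.FiniteType k (A ⊗[R] A) := .trans (S := A) inferInstance inferInstance
  refine mem_radical_of_forall_algHom (k := k) fun φ hφ => ?_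
  refine hf (φ.comp Algebra.TensorProduct.includeLeft)
    (φ.comp (Algebra.TensorProduct.includeRight.restrictScalars k)) (fun r => ?_)
    (hφ (Ideal.mem_span_singleton_self _))
  simp [Algebra.TensorProduct.tmul_one_eq_one_tmul]

/-- The hypothesis on `f` is that its zero set is a union of fibres of `Spec A → Spec R`. The point
`z` is taken on a component of `Spec A` dominating one of `Spec R`, so that `f` cannot vanish
identically on that component. -/
theorem exists_algHom_forall_exists_dvd_algebraMap (k : Type*) {R A : Type*} [Field k]
    [IsAlgClosed k] [CommRing R] [Nontrivial R] [CommRing A] [Algebra k R] [Algebra k A]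
    [Algebra R A] [IsScalarTower k R A] [Algebra.FiniteType k A] [FaithfulSMul R A] :
    ∃ z : A →ₐ[k] k, ∀ f : A, z f ≠ 0 →
      (∀ φ ψ : A →ₐ[k] k,
        (∀ r : R, φ (algebraMap R A r) = ψ (algebraMap R A r)) → φ f = 0 → ψ f = 0) →
      ∃ r : R, r ≠ 0 ∧ f ∣ algebraMap R A r := by
  obtain ⟨p, hp⟩ := Ideal.nonempty_minimalPrimes (bot_ne_top (α := Ideal R))
  obtain ⟨P, hP, rfl⟩ := Ideal.exists_comap_eq_of_mem_minimalPrimes_of_injective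
    (FaithfulSMul.algebraMap_injective R A) p hp
  obtain ⟨z, hz⟩ := exists_algHom_le_ker_of_ne_top (k := k) hP.ne_top
  refine ⟨z, fun f hfz hf => ?_⟩
  obtain ⟨r, hrP, hr⟩ := exists_notMem_dvd_algebraMap P hp (fun h => hfz (hz h))
    (one_tmul_mem_radical_span_tmul_one hf)
  exact ⟨r, by rintro rfl; simp at hrP, hr⟩

end CommutativeAlgebra

section Determinants

theorem exists_det_apply_ne_zero {k α ι : Type*} [Field k] [Fintype ι] [DecidableEq ι]
    {w : ι → α → k} (hw : LinearIndependent k w) :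
    ∃ a : ι → α, (Matrix.of fun i j => w i (a j)).det ≠ 0 := by
  obtain ⟨κ, a, -, hspan, hli⟩ := exists_linearIndependent' k (flip w)
  rw [span_flip_eq_top_iff_linearIndependent.2 hw] at hspan
  let e : ι ≃ κ := (Pi.basisFun k ι).indexEquiv (.mk hli hspan.ge)
  refine ⟨a ∘ e, ?_⟩
  rw [← isUnit_iff_ne_zero, ← Matrix.isUnit_iff_isUnit_det,
    ← Matrix.linearIndependent_cols_iff_isUnit]
  exact hli.comp e e.injective

theorem alternatingMap_sum_smul {R M N ι : Type*} [CommRing R] [AddCommGroup M] [Module R M]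
    [AddCommGroup N] [Module R N] [Fintype ι] [DecidableEq ι] (F : M [⋀^ι]→ₗ[R] N)
    (A : Matrix ι ι R) (v : ι → M) : F (fun i => ∑ j, A i j • v j) = A.det • F v := by
  let b := Pi.basisFun R ι
  let L : (ι → R) →ₗ[R] M := Fintype.linearCombination R v
  have hF : F.compLinearMap L =
      (LinearMap.toSpanSingleton R N (F v)).compAlternatingMap Matrix.detRowAlternating := by
    refine b.ext_alternating fun σ hσ => ?_
    let e := Equiv.ofBijective σ (Finite.injective_iff_bijective.1 hσ)
    have hLb : F.compLinearMap L b = F v := congrArg F (funext fun i => by simp [L, b])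
    have hb : Matrix.detRowAlternating b = (1 : R) := by rw [← Pi.basisFun_det, b.det_self]
    change F.compLinearMap L (b ∘ e) = Matrix.detRowAlternating (b ∘ e) • F v
    rw [AlternatingMap.map_perm, AlternatingMap.map_perm, smul_assoc, hLb, hb, one_smul]
  exact DFunLike.congr_fun hF A

theorem exists_forall_alternatingMap_comp_eq_smul {R M ι : Type*} (N : Type*) [CommRing R]
    [AddCommGroup M] [Module R M] [AddCommGroup N] [Module R N] [Finite ι] {v : ι → M}
    {f : M →ₗ[R] M}
    (hf : ∀ i, f (v i) ∈ Submodule.span R (Set.range v)) :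
    ∃ c : R, ∀ F : M [⋀^ι]→ₗ[R] N, F (f ∘ v) = c • F v := by
  classical
  have := Fintype.ofFinite ι
  choose A hA using fun i => (Submodule.mem_span_range_iff_exists_fun R).1 (hf i)
  refine ⟨(Matrix.of A).det, fun F => ?_⟩
  rw [← alternatingMap_sum_smul]
  congr 1
  ext i
  exact (hA i).symm

end Determinants

section LinearRepresentations

open Representation

variable {k G M N : Type*} [CommSemiring k] [Group G] [AddCommMonoid M] [Module k M]
  [AddCommMonoid N] [Module k N]

/-- The smallest subrepresentation of `ρ` containing the subspace `W`. -/
def orbitSpan (ρ : Representation k G M) (W : Submodule k M) : Subrepresentation ρ where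
  toSubmodule := ⨆ x, W.map (ρ x)
  apply_mem_toSubmodule x := by
    suffices ⨆ y, W.map (ρ y) ≤ (⨆ y, W.map (ρ y)).comap (ρ x) from @this
    refine iSup_le fun y => ?_
    rw [← Submodule.map_le_iff_le_comap, ← Submodule.map_comp, ← Module.End.mul_eq_comp, ← map_mul]
    exact le_iSup (fun y => W.map (ρ y)) (x * y)

theorem le_orbitSpan (ρ : Representation k G M) (W : Submodule k M) :
    W ≤ (orbitSpan ρ W).toSubmodule := by
  refine le_iSup_of_le 1 ?_
  rw [map_one, Module.End.one_eq_id, Submodule.map_id]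

theorem orbitSpan_le {ρ : Representation k G M} {W : Submodule k M} {P : Subrepresentation ρ}
    (hW : W ≤ P.toSubmodule) : (orbitSpan ρ W).toSubmodule ≤ P.toSubmodule :=
  iSup_le fun x => Submodule.map_le_iff_le_comap.2 (hW.trans (P.apply_mem_toSubmodule x))

/-- The inclusion of a subrepresentation. -/
def subrepresentationInclusion {ρ : Representation k G M} (P : Subrepresentation ρ) :
    IntertwiningMap P.toRepresentation ρ where
  toLinearMap := P.toSubmodule.subtype
  isIntertwining' _ := rfl

/-- An intertwining map of representations of `G`, seen as one of representations of a subgroup. -/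
def restrictIntertwining {ρ : Representation k G M} {σ : Representation k G N}
    (φ : IntertwiningMap ρ σ) (H : Subgroup G) :
    IntertwiningMap (ρ.comp H.subtype) (σ.comp H.subtype) where
  toLinearMap := φ.toLinearMap
  isIntertwining' h := φ.isIntertwining' h

/-- The representation on `ι → M` obtained from `ρ` by acting on each component. -/
def powerRep (ι : Type*) (ρ : Representation k G M) : Representation k G (ι → M) where
  toFun x := (ρ x).compLeft ι
  map_one' := by ext; simp
  map_mul' _ _ := by ext; simp

/-- The representation on `N` obtained from `ρ` through an isomorphism `M ≃ N`. -/
def transportRep (e : M ≃ₗ[k] N) (ρ : Representation k G M) : Representation k G N :=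
  (e.conjRingEquiv : Module.End k M →* Module.End k N).comp ρ

/-- A linear isomorphism intertwines a representation with its transport. -/
def transportEquiv (e : M ≃ₗ[k] N) (ρ : Representation k G M) : ρ.Equiv (transportRep e ρ) :=
  .mk e fun x => by ext m; simp [transportRep]

end LinearRepresentations

namespace AffineAlgebraicGroup

open Representation

variable {k : Type u} {G : Type v} [Field k] [Group G] {𝔾 : AffineAlgebraicGroup k G}

section Translations

variable (𝔾)

/-- The point `x` of `G`, seen as the homomorphism `f ↦ f x` on `k[G]`. -/
def evalHom (x : G) : 𝔾.coordRing →ₐ[k] k :=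
  (Pi.evalAlgHom k (fun _ : G => k) x).comp 𝔾.coordRing.val

@[simp]
theorem evalHom_apply (x : G) (f : 𝔾.coordRing) : 𝔾.evalHom x f = (f : G → k) x := rfl

theorem exists_evalHom_eq (φ : 𝔾.coordRing →ₐ[k] k) : ∃ x, 𝔾.evalHom x = φ :=
  𝔾.bijective_eval.2 φ

/-- The algebra homomorphism of `k[G]` sending `f` to the function `y ↦ f (x y)`. -/
def leftTranslate (x : G) : 𝔾.coordRing →ₐ[k] 𝔾.coordRing where
  toFun f := ⟨fun y => (f : G → k) (x * y), 𝔾.comp_mul_left_mem x f⟩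
  map_one' := rfl
  map_mul' _ _ := rfl
  map_zero' := rfl
  map_add' _ _ := rfl
  commutes' _ := rfl

@[simp]
theorem leftTranslate_apply (x y : G) (f : 𝔾.coordRing) :
    (𝔾.leftTranslate x f : G → k) y = (f : G → k) (x * y) := rfl

theorem leftTranslate_mul_apply (x y : G) (f : 𝔾.coordRing) :
    𝔾.leftTranslate (x * y) f = 𝔾.leftTranslate y (𝔾.leftTranslate x f) := by
  ext z
  simp [mul_assoc]

theorem leftTranslate_one_apply (f : 𝔾.coordRing) : 𝔾.leftTranslate 1 f = f := by
  ext y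
  simp

theorem leftTranslate_injective (x : G) : Function.Injective (𝔾.leftTranslate x) := by
  intro f g hfg
  ext y
  simpa using congrFun (congrArg Subtype.val hfg) (x⁻¹ * y)

theorem translate_leftTranslate (x y : G) (f : 𝔾.coordRing) :
    𝔾.translate x (𝔾.leftTranslate y f) = 𝔾.leftTranslate y (𝔾.translate x f) := by
  ext z
  simp [mul_assoc]

theorem translate_injective (x : G) : Function.Injective (𝔾.translate x) := by
  intro f g hfg
  ext y
  simpa using congrFun (congrArg Subtype.val hfg) (y * x⁻¹)

end Translations

section FixedSubalgebra

variable {H : 𝔾.ClosedSubgroup}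

theorem galoisConnection_fixedSubalgebra_stab : GaloisConnection
    (fun H : 𝔾.ClosedSubgroup => OrderDual.toDual (𝔾.fixedSubalgebra H))
    (fun R : (Subalgebra k 𝔾.coordRing)ᵒᵈ => 𝔾.stab (OrderDual.ofDual R)) :=
  fun _ _ => ⟨fun h _ hx _ hr => h hr _ hx, fun h _ hr _ hx => h hx _ hr⟩

theorem leftTranslate_mem_fixedSubalgebra (x : G) {r : 𝔾.coordRing}
    (hr : r ∈ 𝔾.fixedSubalgebra H) : 𝔾.leftTranslate x r ∈ 𝔾.fixedSubalgebra H :=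
  fun h hh => by rw [translate_leftTranslate, hr h hh]

theorem inv_mul_mem_stab_fixedSubalgebra {x y : G}
    (hxy : ∀ r ∈ 𝔾.fixedSubalgebra H, (r : G → k) x = (r : G → k) y) :
    x⁻¹ * y ∈ (𝔾.stab (𝔾.fixedSubalgebra H)).1 := by
  intro r hr
  ext z
  simpa [mul_assoc] using (hxy _ (leftTranslate_mem_fixedSubalgebra (z * x⁻¹) hr)).symm

theorem exists_mul_mem_fixedSubalgebra [IsAlgClosed k]
    (hH : 𝔾.stab (𝔾.fixedSubalgebra H) = H) {f : 𝔾.coordRing} (hf₀ : f ≠ 0)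
    (hf : ∀ (x : G), ∀ h ∈ H.1, (f : G → k) x = 0 → (f : G → k) (x * h) = 0) :
    ∃ g, f * g ≠ 0 ∧ f * g ∈ 𝔾.fixedSubalgebra H := by
  have : Algebra.FiniteType k 𝔾.coordRing := 𝔾.coordRing.fg_iff_finiteType.1 𝔾.fg
  obtain ⟨φ, hφ⟩ := exists_algHom_forall_exists_dvd_algebraMap k
    (R := 𝔾.fixedSubalgebra H) (A := 𝔾.coordRing)
  obtain ⟨z, rfl⟩ := 𝔾.exists_evalHom_eq φ
  obtain ⟨x, hx⟩ := Function.ne_iff.1 (Subtype.val_injective.ne hf₀)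
  obtain ⟨r, hr₀, g, hg⟩ := hφ (𝔾.leftTranslate (x * z⁻¹) f) (by simpa using hx)
    fun φ ψ hφψ hφf => by
      obtain ⟨a, rfl⟩ := 𝔾.exists_evalHom_eq φ
      obtain ⟨b, rfl⟩ := 𝔾.exists_evalHom_eq ψ
      have hab : a⁻¹ * b ∈ H.1 :=
        hH ▸ inv_mul_mem_stab_fixedSubalgebra fun r hr => hφψ ⟨r, hr⟩
      simpa [mul_assoc] using hf _ _ hab hφf
  have hfg : f * 𝔾.leftTranslate (z * x⁻¹) g = 𝔾.leftTranslate (z * x⁻¹) r := by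
    apply 𝔾.leftTranslate_injective (x * z⁻¹)
    simpa [← leftTranslate_mul_apply, leftTranslate_one_apply] using hg.symm
  refine ⟨𝔾.leftTranslate (z * x⁻¹) g, ?_, ?_⟩
  · rw [hfg]
    exact (map_ne_zero_iff _ (𝔾.leftTranslate_injective _)).2 (Subtype.val_injective.ne hr₀)
  · rw [hfg]
    exact leftTranslate_mem_fixedSubalgebra _ r.2

end FixedSubalgebra

section Semiinvariants

variable {H : 𝔾.ClosedSubgroup} {χ : H.1 → k}

variable (𝔾 H χ) in
/-- The polynomial functions on which `H` acts through the weight `χ`. Only when there is a nonzero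
one is `χ` forced to be a character of `H`. -/
def semiinvariants : Submodule k 𝔾.coordRing where
  carrier := {f | ∀ h : H.1, 𝔾.translate h f = χ h • f}
  add_mem' hf hg h := by rw [map_add, hf h, hg h, smul_add]
  zero_mem' h := by rw [map_zero, smul_zero]
  smul_mem' c f hf h := by rw [map_smul, hf h, smul_comm]

theorem weight_ne_zero {f : 𝔾.coordRing} (hf : f ∈ 𝔾.semiinvariants H χ) (hf₀ : f ≠ 0)
    (h : H.1) : χ h ≠ 0 := fun hχ =>
  hf₀ (𝔾.translate_injective h (by rw [hf h, hχ, zero_smul, map_zero]))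

theorem leftTranslate_mem_semiinvariants (x : G) {f : 𝔾.coordRing}
    (hf : f ∈ 𝔾.semiinvariants H χ) : 𝔾.leftTranslate x f ∈ 𝔾.semiinvariants H χ :=
  fun h => by rw [translate_leftTranslate, hf h, map_smul]

theorem exists_mem_semiinvariants_inv [IsAlgClosed k] (hH : 𝔾.stab (𝔾.fixedSubalgebra H) = H)
    {f : 𝔾.coordRing} (hf : f ∈ 𝔾.semiinvariants H χ) (hf₀ : f ≠ 0) (y : G) :
    ∃ g ∈ 𝔾.semiinvariants H χ⁻¹, (g : G → k) y ≠ 0 := by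
  have hχ := weight_ne_zero hf hf₀
  obtain ⟨g, hfg₀, hfg⟩ := exists_mul_mem_fixedSubalgebra hH hf₀ fun x h hh hx => by
    have := congrFun (congrArg Subtype.val (hf ⟨h, hh⟩)) x
    simpa [hx] using this
  obtain ⟨x, hx⟩ := Function.ne_iff.1 (Subtype.val_injective.ne hfg₀)
  have hmem : f * g * g ∈ 𝔾.semiinvariants H χ⁻¹ := fun h => by
    have hfh : χ h • (f * 𝔾.translate h g) = f * g := by
      rw [← smul_mul_assoc, ← hf h, ← map_mul, hfg h h.2]
    rw [map_mul, hfg h h.2, Pi.inv_apply, eq_inv_smul_iff₀ (hχ h), mul_right_comm, ← smul_mul_assoc,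
      hfh]
  refine ⟨𝔾.leftTranslate (x * y⁻¹) (f * g * g), leftTranslate_mem_semiinvariants _ hmem, ?_⟩
  simp_all

end Semiinvariants

section RegularRep

variable (𝔾)

/-- The right regular representation of `G` on `k[G]`, in which `x` acts by `f ↦ x · f`. -/
def regularRep : Representation k G 𝔾.coordRing where
  toFun x := (𝔾.translate x).toLinearMap
  map_one' := by ext; simp
  map_mul' x y := by ext; simp [mul_assoc]

@[simp]
theorem regularRep_apply (x : G) (f : 𝔾.coordRing) : 𝔾.regularRep x f = 𝔾.translate x f := rfl

/-- The alternating map `v ↦ det (vᵢ (aⱼ ·))`, with values in `k[G]`, attached to points `aⱼ`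
of `G`. -/
def translateDet {ι : Type*} [Fintype ι] [DecidableEq ι] (a : ι → G) :
    𝔾.coordRing [⋀^ι]→ₗ[k] 𝔾.coordRing where
  __ := (Matrix.detRowAlternating.toMultilinearMap.restrictScalars k).compLinearMap
    fun _ => LinearMap.pi fun j => (𝔾.leftTranslate (a j)).toLinearMap
  map_eq_zero_of_eq' _ _ _ hv hij :=
    Matrix.detRowAlternating.map_eq_zero_of_eq _ (by simp [hv]) hij

variable {ι : Type*} [Fintype ι] [DecidableEq ι] (a : ι → G) (v : ι → 𝔾.coordRing)

theorem translateDet_eq_det :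
    𝔾.translateDet a v = (Matrix.of fun i j => 𝔾.leftTranslate (a j) (v i)).det := rfl

theorem translateDet_apply_one :
    (𝔾.translateDet a v : G → k) 1 = (Matrix.of fun i j => (v i : G → k) (a j)).det := by
  rw [translateDet_eq_det, ← evalHom_apply, AlgHom.map_det]
  congr 1
  ext i j
  simp

theorem translate_translateDet (x : G) :
    𝔾.translate x (𝔾.translateDet a v) = 𝔾.translateDet a (𝔾.regularRep x ∘ v) := by
  rw [translateDet_eq_det, translateDet_eq_det, AlgHom.map_det]
  congr 1
  ext i j : 2
  simp [translate_leftTranslate]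

variable {𝔾}

theorem exists_translateDet_apply_one_ne_zero {v : ι → 𝔾.coordRing}
    (hv : LinearIndependent k v) : ∃ a : ι → G, (𝔾.translateDet a v : G → k) 1 ≠ 0 := by
  obtain ⟨a, ha⟩ := exists_det_apply_ne_zero
    (hv.map' 𝔾.coordRing.val.toLinearMap (LinearMap.ker_eq_bot.2 Subtype.val_injective))
  exact ⟨a, by rwa [translateDet_apply_one]⟩

theorem exists_intertwiningMap_le_ker_apply_ne_zero [IsAlgClosed k] {H : 𝔾.ClosedSubgroup}
    (hH : 𝔾.stab (𝔾.fixedSubalgebra H) = H)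
    (K : Subrepresentation (𝔾.regularRep.comp H.1.subtype)) [Module.Finite k K.toSubmodule]
    {u : 𝔾.coordRing} (hu : u ∉ K.toSubmodule) :
    ∃ Ψ : IntertwiningMap (𝔾.regularRep.comp H.1.subtype) (𝔾.regularRep.comp H.1.subtype),
      K.toSubmodule ≤ LinearMap.ker Ψ.toLinearMap ∧ Ψ u ≠ 0 := by
  have : Module.Finite k (Submodule.span k (K.toSubmodule : Set 𝔾.coordRing)) := by
    rwa [K.toSubmodule.span_eq]
  obtain ⟨v, hvK, hspan, hv⟩ :=
    Submodule.exists_fun_fin_finrank_span_eq k (K.toSubmodule : Set 𝔾.coordRing)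
  replace hspan := hspan.trans K.toSubmodule.span_eq
  choose χ hχ using fun h : H.1 =>
    exists_forall_alternatingMap_comp_eq_smul 𝔾.coordRing (v := v) (f := 𝔾.regularRep h)
      fun i => hspan.ge (K.apply_mem_toSubmodule h (hvK i))
  obtain ⟨b, hb⟩ := exists_translateDet_apply_one_ne_zero hv
  obtain ⟨a, ha⟩ := exists_translateDet_apply_one_ne_zero (hv.finCons (x := u) (by rwa [hspan]))
  have hf₀ : 𝔾.translateDet b v ≠ 0 := fun h => hb (by rw [h]; rfl)
  have hf : 𝔾.translateDet b v ∈ 𝔾.semiinvariants H χ := fun h => by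
    rw [translate_translateDet, hχ]
  obtain ⟨g, hg, hg₁⟩ := exists_mem_semiinvariants_inv hH hf hf₀ 1
  let F := 𝔾.translateDet a
  have hF (h : H.1) (f : 𝔾.coordRing) : 𝔾.translate h (F (Matrix.vecCons f v)) =
      χ h • F (Matrix.vecCons (𝔾.regularRep h f) v) := by
    rw [translate_translateDet,
      show 𝔾.regularRep h ∘ Matrix.vecCons f v = Matrix.vecCons _ _ from Fin.comp_cons ..]
    exact hχ h (F.curryLeft (𝔾.regularRep h f))
  let Ψ : 𝔾.coordRing →ₗ[k] 𝔾.coordRing :=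
    { toFun f := g * F (Matrix.vecCons f v)
      map_add' _ _ := by rw [F.map_vecCons_add, mul_add]
      map_smul' _ _ := by rw [F.map_vecCons_smul, mul_smul_comm, RingHom.id_apply] }
  refine ⟨⟨Ψ, fun h => LinearMap.ext fun f => ?_⟩, ?_, ?_⟩
  · change g * F _ = 𝔾.translate h (g * F _)
    rw [map_mul, hg h, hF, smul_mul_smul_comm, Pi.inv_apply,
      inv_mul_cancel₀ (weight_ne_zero hf hf₀ h), one_smul]
    rfl
  · refine hspan.ge.trans (Submodule.span_le.2 ?_)
    rintro _ ⟨i, rfl⟩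
    have : F (Matrix.vecCons (v i) v) = 0 :=
      F.map_eq_zero_of_eq _ (by simp) (Fin.succ_ne_zero i).symm
    exact (congrArg (g * ·) this).trans (mul_zero g)
  · exact fun h => mul_ne_zero hg₁ ha (congrFun (congrArg Subtype.val h) 1)

end RegularRep

section RationalRepresentations

variable {M N : Type*} [AddCommGroup M] [Module k M] [AddCommGroup N] [Module k N]
  {ρ : Representation k G M} {σ : Representation k G N}

variable (𝔾) in
theorem isRational_regularRep : 𝔾.IsRational 𝔾.regularRep := by
  intro f
  obtain ⟨n, f₁, f₂, hf⟩ := 𝔾.mul_mem f f.2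
  refine ⟨n, f₁, f₂, fun x => ?_⟩
  ext y
  simp [hf, mul_comm]

theorem IsRational.of_injective (hσ : 𝔾.IsRational σ) (φ : IntertwiningMap ρ σ)
    (hφ : Function.Injective φ) : 𝔾.IsRational ρ := by
  intro m
  obtain ⟨p, hp⟩ := φ.toLinearMap.exists_leftInverse_of_injective (LinearMap.ker_eq_bot.2 hφ)
  obtain ⟨n, m', f, hf⟩ := hσ (φ m)
  refine ⟨n, p ∘ m', f, fun x => ?_⟩
  calc ρ x m = p (φ (ρ x m)) := (LinearMap.congr_fun hp _).symm
    _ = p (σ x (φ m)) := by rw [φ.isIntertwining]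
    _ = ∑ i, (f i : G → k) x • p (m' i) := by simp [hf]

theorem IsRational.toRepresentation (hρ : 𝔾.IsRational ρ) (P : Subrepresentation ρ) :
    𝔾.IsRational P.toRepresentation :=
  hρ.of_injective (subrepresentationInclusion P) Subtype.val_injective

theorem IsRational.comp_subtype (hρ : 𝔾.IsRational ρ) (H : 𝔾.ClosedSubgroup) :
    (𝔾.toAffineAlgebraicGroup H).IsRational (ρ.comp H.1.subtype) := by
  intro m
  obtain ⟨n, m', f, hf⟩ := hρ m
  exact ⟨n, m', fun i => ⟨restrict H.1 (f i), f i, (f i).2, rfl⟩, fun h => hf h⟩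

theorem IsRational.coeff_mem (hρ : 𝔾.IsRational ρ) (l : Module.Dual k M) (m : M) :
    (fun x => l (ρ x m)) ∈ 𝔾.coordRing := by
  obtain ⟨n, m', f, hf⟩ := hρ m
  have : (fun x => l (ρ x m)) = ∑ i, l (m' i) • (f i : G → k) := by
    ext x
    simp [hf, mul_comm]
  rw [this]
  exact sum_mem fun i _ => 𝔾.coordRing.smul_mem (f i).2 _

theorem IsRational.dual [Module.Finite k M] (hρ : 𝔾.IsRational ρ) : 𝔾.IsRational ρ.dual := by
  intro l
  let b := Module.finBasis k M
  refine ⟨_, b.coord, fun i => ⟨_, 𝔾.inv_mem _ (hρ.coeff_mem l (b i))⟩, fun x => ?_⟩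
  refine b.ext fun j => ?_
  simp [Module.Dual.transpose_apply, Finsupp.single_apply]

theorem IsRational.powerRep {ι : Type*} [Finite ι] (hρ : 𝔾.IsRational ρ) :
    𝔾.IsRational (powerRep ι ρ) := by
  classical
  have := Fintype.ofFinite ι
  intro v
  choose n m' f hf using fun i => hρ (v i)
  let e := (Fintype.equivFin (Σ i, Fin (n i))).symm
  let F (x : G) (p : Σ i, Fin (n i)) : ι → M := (f p.1 p.2 : G → k) x • Pi.single p.1 (m' p.1 p.2)
  refine ⟨_, fun j => Pi.single (e j).1 (m' _ (e j).2), fun j => f _ (e j).2, fun x => ?_⟩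
  calc _root_.powerRep ι ρ x v = ∑ i, Pi.single i (ρ x (v i)) :=
        (Finset.univ_sum_single (fun i => ρ x (v i))).symm
    _ = ∑ i, ∑ j, F x ⟨i, j⟩ := by
      simp only [hf, F, ← LinearMap.single_apply (R := k), map_sum, map_smul]
    _ = ∑ j, F x (e j) := by rw [e.sum_comp, Fintype.sum_sigma]

theorem IsRational.finite_orbitSpan (hρ : 𝔾.IsRational ρ) (W : Submodule k M)
    [Module.Finite k W] : Module.Finite k (orbitSpan ρ W).toSubmodule := by
  obtain ⟨s, hs⟩ := W.fg_iff_finiteDimensional.2 ‹_›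
  choose n m' f hf using hρ
  have := FiniteDimensional.span_of_finite k
    (s.finite_toSet.biUnion fun m _ => Set.finite_range (m' m))
  refine Submodule.finiteDimensional_of_le (iSup_le fun x => ?_ :
    _ ≤ Submodule.span k (⋃ m ∈ (s : Set M), Set.range (m' m)))
  rw [← hs, Submodule.map_span, Submodule.span_le]
  rintro _ ⟨m, hm, rfl⟩
  rw [hf]
  exact sum_mem fun i _ => Submodule.smul_mem _ _ <| Submodule.subset_span <|
    Set.mem_biUnion hm ⟨i, rfl⟩

end RationalRepresentations

section Extensions

variable {H : 𝔾.ClosedSubgroup} {M N : Type*} [AddCommGroup M] [Module k M] [Module.Finite k M]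
  [AddCommGroup N] [Module k N] {σ : Representation k H.1 M}

/-- The representation `σ` of `H` embeds into the restriction to `H` of a finite dimensional
rational representation of `G`. The space of the latter is taken in the universe of `k`, as in
`IsObservable`, while that of `σ` may be in any universe. -/
def IsExtendible (σ : Representation k H.1 M) : Prop :=
  ∃ (N : Type u) (_ : AddCommGroup N) (_ : Module k N) (_ : Module.Finite k N)
    (ρ : Representation k G N) (φ : IntertwiningMap σ (ρ.comp H.1.subtype)),
    𝔾.IsRational ρ ∧ Function.Injective φ

theorem IsRational.isExtendible {ρ : Representation k G N} (hρ : 𝔾.IsRational ρ)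
    (φ : IntertwiningMap σ (ρ.comp H.1.subtype)) (hφ : Function.Injective φ) :
    IsExtendible σ := by
  have := hρ.finite_orbitSpan (LinearMap.range φ.toLinearMap)
  let P := orbitSpan ρ (LinearMap.range φ.toLinearMap)
  let ψ : IntertwiningMap σ (P.toRepresentation.comp H.1.subtype) :=
    { toLinearMap := φ.toLinearMap.codRestrict _ fun m => le_orbitSpan _ _ ⟨m, rfl⟩
      isIntertwining' h := by
        ext m
        exact φ.isIntertwining _ _ h m }
  let e := transportEquiv (Module.finBasis k P.toSubmodule).equivFun P.toRepresentation
  refine ⟨_, inferInstance, inferInstance, inferInstance, _,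
    (restrictIntertwining e.toIntertwiningMap H.1).comp ψ, ?_, ?_⟩
  · exact (hρ.toRepresentation P).of_injective
      e.symm.toIntertwiningMap e.symm.toLinearEquiv.injective
  · exact e.toLinearEquiv.injective.comp fun m m' h => hφ (congrArg Subtype.val h)

theorem IsObservable.isExtendible (hH : 𝔾.IsObservable H)
    (hσ : (𝔾.toAffineAlgebraicGroup H).IsRational σ) : IsExtendible σ := by
  let e := transportEquiv (Module.finBasis k M).equivFun σ
  obtain ⟨N, _, _, _, ρ, φ, hρ, hφ, hφ'⟩ := hH _ _
    (hσ.of_injective e.symm.toIntertwiningMap e.symm.toLinearEquiv.injective)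
  refine hρ.isExtendible (.comp ⟨φ, fun h => LinearMap.ext (hφ' h)⟩ e.toIntertwiningMap) ?_
  exact hφ.comp e.toLinearEquiv.injective

theorem IsObservable.isExtendible_dual (hH : 𝔾.IsObservable H)
    (hσ : (𝔾.toAffineAlgebraicGroup H).IsRational σ) : IsExtendible σ.dual :=
  hH.isExtendible hσ.dual

end Extensions

variable {H : 𝔾.ClosedSubgroup}

variable (H) in
/-- The polynomial functions vanishing on `H`, as a subrepresentation of `k[G]` over `H`. -/
def vanishingSubrepresentation : Subrepresentation (𝔾.regularRep.comp H.1.subtype) where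
  toSubmodule := ⨅ h : H.1, LinearMap.ker (𝔾.evalHom h).toLinearMap
  apply_mem_toSubmodule h f hf := by
    simp only [Submodule.mem_iInf] at hf ⊢
    exact fun y => hf (y * h)

theorem mem_vanishingSubrepresentation {f : 𝔾.coordRing} :
    f ∈ (vanishingSubrepresentation H).toSubmodule ↔ ∀ h : H.1, (f : G → k) h = 0 :=
  Submodule.mem_iInf _

section OfObservable

/-- Evaluation at `x`, as a linear form on a space of polynomial functions. -/
def evalDual (W : Submodule k 𝔾.coordRing) (x : G) : Module.Dual k W :=
  (𝔾.evalHom x).toLinearMap.domRestrict W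

theorem dual_evalDual_mul (W : Subrepresentation (𝔾.regularRep.comp H.1.subtype)) (x : G)
    (h : H.1) :
    W.toRepresentation.dual h (evalDual W.toSubmodule (x * h)) = evalDual W.toSubmodule x := by
  ext w
  change (w.1 : G → k) (x * h * (h⁻¹ : H.1)) = (w.1 : G → k) x
  simp

variable {W : Subrepresentation (𝔾.regularRep.comp H.1.subtype)} [Module.Finite k W.toSubmodule]
  {N : Type*} [AddCommGroup N] [Module k N] {ρ : Representation k G N}

theorem exists_mem_fixedSubalgebra_apply_eq (hρ : 𝔾.IsRational ρ)
    (φ : IntertwiningMap W.toRepresentation.dual (ρ.comp H.1.subtype)) (l : Module.Dual k N) :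
    ∃ F ∈ 𝔾.fixedSubalgebra H, ∀ x, (F : G → k) x = l (ρ x (φ (evalDual W.toSubmodule x))) := by
  have : Module.Free k W.toSubmodule := .of_divisionRing k W.toSubmodule
  let b := Module.finBasis k W.toSubmodule
  let F : 𝔾.coordRing := ∑ i, (b i).1 * ⟨_, hρ.coeff_mem l (φ (b.coord i))⟩
  have hF (x : G) : (F : G → k) x = l (ρ x (φ (evalDual W.toSubmodule x))) := by
    have hx : evalDual W.toSubmodule x = ∑ i, ((b i).1 : G → k) x • b.coord i :=
      (b.sum_dual_apply_smul_coord _).symm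
    simp [hx, F]
  refine ⟨F, fun h hh => ?_, hF⟩
  ext x
  rw [translate_apply, hF, hF, map_mul, Module.End.mul_apply]
  congr 2
  rw [← dual_evalDual_mul W x ⟨h, hh⟩]
  exact (φ.isIntertwining _ _ ⟨h, hh⟩ _).symm

theorem IsObservable.apply_eq_zero (hH : 𝔾.IsObservable H) {x : G}
    (hx : x ∈ (𝔾.stab (𝔾.fixedSubalgebra H)).1) {f : 𝔾.coordRing}
    (hf : ∀ h : H.1, (f : G → k) h = 0) : (f : G → k) x = 0 := by
  have hreg := 𝔾.isRational_regularRep.comp_subtype H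
  let W := orbitSpan (𝔾.regularRep.comp H.1.subtype) (Submodule.span k {f})
  have : Module.Finite k W.toSubmodule := hreg.finite_orbitSpan _
  have hW : W.toSubmodule ≤ (vanishingSubrepresentation H).toSubmodule := orbitSpan_le <| by
    rwa [Submodule.span_singleton_le_iff_mem, mem_vanishingSubrepresentation]
  obtain ⟨N, _, _, _, ρ, φ, hρ, hφ⟩ := hH.isExtendible_dual (hreg.toRepresentation W)
  have hone : evalDual W.toSubmodule 1 = 0 := by
    ext w
    exact mem_vanishingSubrepresentation.1 (hW w.2) 1
  have hzero : ρ x (φ (evalDual W.toSubmodule x)) = 0 := by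
    rw [← Module.forall_dual_apply_eq_zero_iff k]
    intro l
    obtain ⟨F, hFH, hF⟩ := exists_mem_fixedSubalgebra_apply_eq hρ φ l
    have hF₁ : (F : G → k) (1 * x) = (F : G → k) 1 :=
      congrFun (congrArg Subtype.val (hx F hFH)) 1
    rw [← hF, ← one_mul x, hF₁, hF, hone, map_zero, map_zero, map_zero]
  have hevx : evalDual W.toSubmodule x = 0 := by
    apply hφ
    rw [map_zero, ← ρ.inv_self_apply x (φ _), hzero, map_zero]
  have hfW : f ∈ W.toSubmodule := le_orbitSpan _ _ (Submodule.mem_span_singleton_self f)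
  exact LinearMap.congr_fun hevx ⟨f, hfW⟩

theorem IsObservable.stab_fixedSubalgebra (hH : 𝔾.IsObservable H) :
    𝔾.stab (𝔾.fixedSubalgebra H) = H := by
  refine le_antisymm (fun x hx => ?_)
    (galoisConnection_fixedSubalgebra_stab.le_u_l H)
  obtain ⟨S, hS⟩ := (𝔾.isClosed_iff _).1 H.2
  have hmem (y : G) : y ∈ H.1 ↔ y ∈ 𝔾.zeroLocus S := by rw [← hS, SetLike.mem_coe]
  exact (hmem x).2 fun f hf => hH.apply_eq_zero hx fun h => (hmem h).1 h.2 f hf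

end OfObservable

section ToObservable

variable {M : Type*} [AddCommGroup M] [Module k M] [Module.Finite k M]
  {σ : Representation k H.1 M}

theorem IsRational.exists_linearMap_apply_eq_coeff
    (hσ : (𝔾.toAffineAlgebraicGroup H).IsRational σ) (l : Module.Dual k M) :
    ∃ s : M →ₗ[k] 𝔾.coordRing, ∀ m (h : H.1), (s m : G → k) h = l (σ h m) := by
  let b := Module.finBasis k M
  choose F hF hFb using fun i => hσ.coeff_mem l (b i)
  refine ⟨b.constr k fun i => ⟨F i, hF i⟩, fun m h => ?_⟩
  suffices (𝔾.evalHom h).toLinearMap ∘ₗ b.constr k (fun i => ⟨F i, hF i⟩) = l ∘ₗ σ h from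
    LinearMap.congr_fun this m
  refine b.ext fun i => ?_
  rw [LinearMap.comp_apply, b.constr_basis]
  exact congrFun (hFb i) h

variable [IsAlgClosed k]

theorem IsRational.exists_intertwiningMap_apply_ne_zero
    (hσ : (𝔾.toAffineAlgebraicGroup H).IsRational σ) (hH : 𝔾.stab (𝔾.fixedSubalgebra H) = H)
    {m : M} (hm : m ≠ 0) :
    ∃ Φ : IntertwiningMap σ (𝔾.regularRep.comp H.1.subtype), Φ m ≠ 0 := by
  obtain ⟨l, hl⟩ := Module.Projective.exists_dual_ne_zero k hm
  obtain ⟨s, hs⟩ := hσ.exists_linearMap_apply_eq_coeff l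
  let V := orbitSpan (𝔾.regularRep.comp H.1.subtype) (LinearMap.range s)
  have : Module.Finite k V.toSubmodule :=
    (𝔾.isRational_regularRep.comp_subtype H).finite_orbitSpan _
  have hsV (m : M) : s m ∈ V.toSubmodule := le_orbitSpan _ _ ⟨m, rfl⟩
  let K := V ⊓ vanishingSubrepresentation H
  have : Module.Finite k K.toSubmodule :=
    Submodule.finiteDimensional_of_le (inf_le_left : K.toSubmodule ≤ V.toSubmodule)
  have hsK : s m ∉ K.toSubmodule := fun hK => hl <| by
    rw [← Module.End.one_apply (R := k) m, ← map_one σ, ← hs]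
    exact mem_vanishingSubrepresentation.1 hK.2 1
  obtain ⟨Ψ, hΨK, hΨ⟩ := exists_intertwiningMap_le_ker_apply_ne_zero hH K hsK
  refine ⟨⟨Ψ.toLinearMap ∘ₗ s, fun h => LinearMap.ext fun m => ?_⟩, hΨ⟩
  have hK : s (σ h m) - 𝔾.regularRep h (s m) ∈ K.toSubmodule := by
    refine ⟨sub_mem (hsV _) (V.apply_mem_toSubmodule h (hsV m)),
      mem_vanishingSubrepresentation.2 fun y => sub_eq_zero.2 ?_⟩
    calc (s (σ h m) : G → k) y = l (σ (y * h) m) := by rw [hs, map_mul, Module.End.mul_apply]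
      _ = (s m : G → k) (y * h) := (hs m (y * h)).symm
  calc Ψ (s (σ h m)) = Ψ (𝔾.regularRep h (s m)) := sub_eq_zero.1 <| by
        rw [← map_sub]
        exact hΨK hK
    _ = 𝔾.regularRep h (Ψ (s m)) := Ψ.isIntertwining _ _ h (s m)

theorem isObservable_of_stab_fixedSubalgebra (hH : 𝔾.stab (𝔾.fixedSubalgebra H) = H) :
    𝔾.IsObservable H := by
  intro M _ _ _ σ hσ
  obtain ⟨t, ht⟩ := Finset.exists_inf_eq_iInf
    fun Φ : IntertwiningMap σ (𝔾.regularRep.comp H.1.subtype) => LinearMap.ker Φ.toLinearMap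
  let Φ : IntertwiningMap σ ((powerRep t 𝔾.regularRep).comp H.1.subtype) :=
    { toLinearMap := LinearMap.pi fun Φ : t => Φ.1.toLinearMap
      isIntertwining' h := by
        ext m Φ : 2
        exact Φ.1.isIntertwining _ _ h m }
  have hΦ : Function.Injective Φ := by
    rw [injective_iff_map_eq_zero]
    intro m hm
    by_contra hm₀
    obtain ⟨Θ, hΘ⟩ := hσ.exists_intertwiningMap_apply_ne_zero hH hm₀
    have hmt : m ∈ t.inf fun Φ => LinearMap.ker Φ.toLinearMap :=
      Submodule.mem_finsetInf.2 fun Φ hΦ => congrFun hm ⟨Φ, hΦ⟩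
    rw [ht, Submodule.mem_iInf] at hmt
    exact hΘ (hmt Θ)
  obtain ⟨N, _, _, _, ρ, ι, hρ, hι⟩ := 𝔾.isRational_regularRep.powerRep.isExtendible Φ hΦ
  exact ⟨N, _, _, ‹_›, ρ, ι.toLinearMap, hρ, hι, ι.isIntertwining _ _⟩

end ToObservable

end AffineAlgebraicGroup

theorem theorem3p5_general {k : Type u} [Field k] [IsAlgClosed k] {G : Type v} [Group G]
    (𝔾 : AffineAlgebraicGroup k G) :
    GaloisConnection
        (fun H : 𝔾.ClosedSubgroup => OrderDual.toDual (𝔾.fixedSubalgebra H))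
        (fun R : (Subalgebra k 𝔾.coordRing)ᵒᵈ => 𝔾.stab (OrderDual.ofDual R)) ∧
      {H : 𝔾.ClosedSubgroup | 𝔾.stab (𝔾.fixedSubalgebra H) = H} =
        {H : 𝔾.ClosedSubgroup | 𝔾.IsObservable H} := by
  refine ⟨AffineAlgebraicGroup.galoisConnection_fixedSubalgebra_stab, Set.ext fun H => ?_⟩
  exact ⟨AffineAlgebraicGroup.isObservable_of_stab_fixedSubalgebra,
    AffineAlgebraicGroup.IsObservable.stab_fixedSubalgebra⟩

theorem theorem3p5 {k : Type u} [Field k] [IsAlgClosed k] {G : Type v} [Group G]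
    (𝔾 : AffineAlgebraicGroup k G) (hG : 𝔾.IsConnected) :
    GaloisConnection
        (fun H : 𝔾.ClosedSubgroup => OrderDual.toDual (𝔾.fixedSubalgebra H))
        (fun R : (Subalgebra k 𝔾.coordRing)ᵒᵈ => 𝔾.stab (OrderDual.ofDual R)) ∧
      {H : 𝔾.ClosedSubgroup | 𝔾.stab (𝔾.fixedSubalgebra H) = H} =
        {H : 𝔾.ClosedSubgroup | 𝔾.IsObservable H} :=
  theorem3p5_general 𝔾
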